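/- Let $k,\mu,\lambda\in\mathbb{C}$ with $k\neq 0$, $2\mu\notin\{-1,-2,-3,\dots\}$ and $2\lambda\notin\{0,-1,-2,\dots\}$. Write $${}_pF_q(a_1,\dots,a_p;b_1,\dots,b_q;z)=\sum_{n=0}^\infty\frac{(a_1)_n\cdots(a_p)_n}{(b_1)_n\cdots(b_q)_n}\frac{z^n}{n!},\qquad (c)_g=\frac{\Gamma(g+c)}{\Gamma(c)}$$ (with $(a)_n$ in the series being the rising factorial $a(a+1)\cdots(a+n-1)$), let $$J_\nu(z)=\Big(\frac z2\Big)^{\nu}\sum_{m=0}^\infty\frac{(-1)^m}{m!\,\Gamma(m+\nu+1)}\Big(\frac z2\Big)^{2m}$$ be the Bessel function of the first kind, and let all powers be principal values. Then $${}_2F_3\Big(\tfrac{\mu}{2}+\tfrac14,\tfrac{\mu}{2}+\tfrac34;\lambda+1,\mu+\tfrac12,\mu+1;-k^2\Big)=\frac{2^{\mu-\frac12}\,\Gamma(\lambda+1)\Gamma(\mu+1)}{\Gamma(\lambda+\frac12)\Gamma(\lambda)^2}\sum_{L=0}^\infty c_L\,J_{2L+\lambda}(k)\;{}_1F_2\Big(L+\tfrac12;2L+\lambda+1,L+\mu+1;-\tfrac{k^2}{4}\Big),$$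 where $$c_L=\frac{(-1)^{2L}\,k^{2L-\lambda}\,\big((\lambda+\frac12)_{2L}\big)^2\,2^{6L-\lambda-\mu+\frac32}\,\Gamma(2L+\lambda+1)\,\Gamma(2L+2\lambda)}{(2L)!\,(2L+\lambda)\,\big((2\lambda)_{2L}\big)^2\,\big((2L+2\lambda)_{2L}\big)^2\,\big(L+\frac12\big)_{\mu+\frac12}},$$ and the series over $L$ converges absolutely. -/

import Mathlib

/-- The generalized hypergeometric function `pFq(a₁,…,a_p; b₁,…,b_q; z)`, as the sum of the series
`∑ₙ ((a₁)ₙ ⋯ (a_p)ₙ) / ((b₁)ₙ ⋯ (b_q)ₙ) * zⁿ / n!`, where `(c)ₙ` is the rising factorial.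
(For `p ≤ q` and no `bⱼ` in `{0, -1, -2, …}` it converges absolutely for every `z`.) -/
noncomputable def hypergeometricPFQ (a b : List ℂ) (z : ℂ) : ℂ :=
  ∑' n : ℕ, (a.map fun c => (ascPochhammer ℂ n).eval c).prod /
    (b.map fun c => (ascPochhammer ℂ n).eval c).prod * (z ^ n / (n.factorial : ℂ))

/-- The Bessel function of the first kind of complex order `ν`,
`J_ν(z) = (z/2)^ν ∑ₘ (-1)^m / (m! Γ(m + ν + 1)) (z/2)^(2m)`, with the principal branch of the
power. At a pole of `Γ` the quotient is `0` in Lean, which is the usual convention `1/Γ = 0`. -/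
noncomputable def besselJ (ν z : ℂ) : ℂ :=
  (z / 2) ^ ν *
    ∑' m : ℕ, (-1) ^ m / ((m.factorial : ℂ) * Complex.Gamma (m + ν + 1)) * (z / 2) ^ (2 * m)

/-- The Pochhammer symbol `(c)_g = Γ(g + c) / Γ(c)` with complex index `g`. -/
noncomputable def pochhammerSymbol (c g : ℂ) : ℂ :=
  Complex.Gamma (g + c) / Complex.Gamma c

/-- The `L`-th term of the series
`∑_L (-1)^(2L) k^(2L-λ) ((λ+1/2)_{2L})² 2^(6L-λ-μ+3/2) Γ(2L+λ+1) Γ(2L+2λ)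
  / ((2L)! (2L+λ) ((2λ)_{2L})² ((2L+2λ)_{2L})² (L+1/2)_{μ+1/2})
  * J_{2L+λ}(k) * 1F2(L+1/2; 2L+λ+1, L+μ+1; -k²/4)`. -/
noncomputable def besselSeriesTerm (k μ lam : ℂ) (L : ℕ) : ℂ :=
  (-1) ^ (2 * L) * k ^ (2 * (L : ℂ) - lam) *
      (pochhammerSymbol (lam + 1 / 2) (2 * L)) ^ 2 *
      (2 : ℂ) ^ (6 * (L : ℂ) - lam - μ + 3 / 2) *
      Complex.Gamma (2 * L + lam + 1) * Complex.Gamma (2 * L + 2 * lam) /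
    (((2 * L).factorial : ℂ) * (2 * L + lam) *
      (pochhammerSymbol (2 * lam) (2 * L)) ^ 2 *
      (pochhammerSymbol (2 * L + 2 * lam) (2 * L)) ^ 2 *
      pochhammerSymbol (L + 1 / 2) (μ + 1 / 2)) *
    besselJ (2 * L + lam) k *
    hypergeometricPFQ [(L : ℂ) + 1 / 2] [2 * (L : ℂ) + lam + 1, (L : ℂ) + μ + 1] (-k ^ 2 / 4)

/-! Put y = -k²/4 and c = μ + 1. Expanding the Bessel function and the ₁F₂ turns the right side,
prefactor included, into a triple series over (L, m, j) with power y^(2L+m+j)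
(`prefactor_mul_besselSeriesTerm`). It converges absolutely (`summable_besselTripleTerm`), so it may
be regrouped.

With a = L + m and s = L + j, the sum over L is finite and well-poised; Dougall's theorem
(`sum_dougallTerm`) leaves binom(2(a+s), 2s) / ((a+s)! (λ+1)_{a+s}), up to the factor λ. On a + s =
n the remaining sum over s is Chu–Vandermonde in disguise (`sum_choose_two_mul_risingFac_div`). The
resulting single series is the ₂F₃ after the duplication formula for rising factorials
(`hypergeometricPFQ_eq_tsum_risingFac`). -/

/-- The rising factorial `(c)ₙ = c (c + 1) ⋯ (c + n - 1)` of a complex number. -/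
noncomputable def risingFac (c : ℂ) (n : ℕ) : ℂ := (ascPochhammer ℂ n).eval c

lemma risingFac_def (c : ℂ) (n : ℕ) : risingFac c n = (ascPochhammer ℂ n).eval c := rfl

@[simp] lemma risingFac_zero (c : ℂ) : risingFac c 0 = 1 := by simp [risingFac]

lemma risingFac_succ (c : ℂ) (n : ℕ) : risingFac c (n + 1) = risingFac c n * (c + n) :=
  ascPochhammer_succ_eval n c

lemma risingFac_add (c : ℂ) (m n : ℕ) :
    risingFac c (m + n) = risingFac c m * risingFac (c + m) n := by
  induction n with
  | zero => simp
  | succ n ih => rw [← add_assoc, risingFac_succ, ih, risingFac_succ]; push_cast; ring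

lemma risingFac_succ_left (c : ℂ) (n : ℕ) : risingFac c (n + 1) = c * risingFac (c + 1) n := by
  rw [add_comm, risingFac_add, ← zero_add 1, risingFac_succ]; simp

lemma risingFac_ne_zero {c : ℂ} (hc : ∀ n : ℕ, c + n ≠ 0) (n : ℕ) : risingFac c n ≠ 0 := by
  induction n with
  | zero => simp
  | succ n ih => rw [risingFac_succ]; exact mul_ne_zero ih (hc n)

lemma risingFac_two_mul (c : ℂ) (n : ℕ) :
    risingFac (2 * c) (2 * n) = 4 ^ n * risingFac c n * risingFac (c + 1 / 2) n := by
  induction n with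
  | zero => simp
  | succ n ih =>
    rw [show 2 * (n + 1) = 2 * n + 1 + 1 by ring, risingFac_succ, risingFac_succ, ih,
      risingFac_succ, risingFac_succ]
    push_cast; ring

lemma Gamma_add_natCast {c : ℂ} (hc : ∀ n : ℕ, c + n ≠ 0) (n : ℕ) :
    Complex.Gamma (c + n) = risingFac c n * Complex.Gamma c := by
  induction n with
  | zero => simp
  | succ n ih =>
    rw [risingFac_succ, Nat.cast_succ, ← add_assoc, Complex.Gamma_add_one _ (hc n), ih]; ring

/-! ### Chu–Vandermonde and a sum over even binomials -/

lemma choose_succ_mul_cast (n k : ℕ) :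
    (n.choose (k + 1) : ℂ) * (k + 1) = n.choose k * (n - k) := by
  rcases le_or_gt k n with h | h
  · rw [← Nat.cast_sub h]; exact_mod_cast Nat.choose_succ_right_eq n k
  · simp [Nat.choose_eq_zero_of_lt h, Nat.choose_eq_zero_of_lt (h.trans (Nat.lt_succ_self k))]

/-- The Chu–Vandermonde identity. -/
lemma sum_choose_mul_descPochhammer_mul_risingFac (n : ℕ) (b c : ℂ) :
    ∑ s ∈ Finset.range (n + 1), (n.choose s : ℂ) *
      ((descPochhammer ℂ s).eval b * risingFac (c + s) (n - s)) = risingFac (b + c) n := by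
  induction n generalizing c with
  | zero => simp
  | succ n ih =>
    -- Pascal's rule pairs two terms with the common factor (c+1+s)_{n-s}; their cofactors c + s and
    -- b - s add up to b + c.
    rw [Finset.sum_choose_succ_mul
      (f := fun s t => (descPochhammer ℂ s).eval b * risingFac (c + s) t), risingFac_succ_left,
      add_assoc, ← ih, ← Finset.sum_add_distrib, Finset.mul_sum]
    refine Finset.sum_congr rfl fun s hs => ?_
    have hs' : s ≤ n := Nat.lt_succ_iff.mp (Finset.mem_range.mp hs)
    rw [Nat.succ_sub hs', Nat.succ_eq_add_one, risingFac_succ_left, descPochhammer_succ_eval,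
      Nat.cast_succ, show c + s + 1 = c + 1 + s by ring, show c + (s + 1) = c + 1 + (s : ℂ) by ring]
    ring

/-- Separating even and odd factors, (2n)!/(2n-2s)! is 4^s times the falling factorials of n and n -
1/2, while (2s)! = 4^s s! (1/2)_s. -/
lemma choose_two_mul_mul_risingFac_half (n s : ℕ) :
    ((2 * n).choose (2 * s) : ℂ) * risingFac (1 / 2) s =
      n.choose s * (descPochhammer ℂ s).eval ((n : ℂ) - 1 / 2) := by
  induction s with
  | zero => simp
  | succ s ih =>
    have h1 := choose_succ_mul_cast (2 * n) (2 * s)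
    have h2 := choose_succ_mul_cast (2 * n) (2 * s + 1)
    have h3 := choose_succ_mul_cast n s
    have hs : (s : ℂ) + 1 ≠ 0 := Nat.cast_add_one_ne_zero s
    rw [risingFac_succ, descPochhammer_succ_eval, show 2 * (s + 1) = 2 * s + 1 + 1 by ring]
    push_cast at h1 h2
    apply mul_right_cancel₀ hs
    linear_combination (risingFac (1 / 2) s / 4) * (2 * s + 1) * h2 +
      (risingFac (1 / 2) s / 4) * (2 * n - 2 * s - 1) * h1 +
      (n - s) * (n - s - 1 / 2) * ih -
      (descPochhammer ℂ s).eval ((n : ℂ) - 1 / 2) * (n - 1 / 2 - s) * h3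

lemma sum_choose_two_mul_risingFac_div {c : ℂ} (hc : ∀ n : ℕ, c + n ≠ 0) (n : ℕ) :
    ∑ s ∈ Finset.range (n + 1), ((2 * n).choose (2 * s) : ℂ) * (risingFac (1 / 2) s /
      risingFac c s) = risingFac (c - 1 / 2 + n) n / risingFac c n := by
  rw [show c - 1 / 2 + n = (n - 1 / 2) + c by ring,
    ← sum_choose_mul_descPochhammer_mul_risingFac, Finset.sum_div]
  refine Finset.sum_congr rfl fun s hs => ?_
  have hs' : s ≤ n := Nat.lt_succ_iff.mp (Finset.mem_range.mp hs)
  have h := risingFac_add c s (n - s)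
  rw [Nat.add_sub_cancel' hs'] at h
  have h0 := risingFac_ne_zero hc s
  have h1 := risingFac_ne_zero hc n
  have h2 : risingFac (c + s) (n - s) ≠ 0 := fun h' => h1 (by rw [h, h', mul_zero])
  rw [← mul_div_assoc, choose_two_mul_mul_risingFac_half, h]
  field_simp

/-! ### Dougall's sum by creative telescoping -/

/-- `1 / (n - k)!`, with the value `0` for `n < k`. -/
noncomputable def invFactorialSub (n k : ℕ) : ℂ := if k ≤ n then 1 / ((n - k).factorial : ℂ) else 0

/-- The value 0 below the diagonal makes this hold for all n and k (at k = n the factor vanishes),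
so the recurrence below needs no range condition. -/
lemma invFactorialSub_succ_right (n k : ℕ) :
    invFactorialSub n (k + 1) = (n - k) * invFactorialSub n k := by
  rcases lt_trichotomy k n with h | rfl | h
  · obtain ⟨d, rfl⟩ := Nat.exists_eq_add_of_lt h
    have : ((d.factorial : ℕ) : ℂ) ≠ 0 := Nat.cast_ne_zero.mpr d.factorial_ne_zero
    have : (d : ℂ) + 1 ≠ 0 := Nat.cast_add_one_ne_zero d
    simp only [invFactorialSub]
    rw [if_pos (by omega), if_pos (by omega), show k + d + 1 - (k + 1) = d by omega,
      show k + d + 1 - k = d + 1 by omega, Nat.factorial_succ]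
    push_cast; field_simp; ring
  · simp [invFactorialSub]
  · simp only [invFactorialSub]
    rw [if_neg (by omega), if_neg (by omega), mul_zero]

lemma invFactorialSub_succ_succ (n k : ℕ) :
    invFactorialSub (n + 1) (k + 1) = invFactorialSub n k := by
  simp [invFactorialSub]

lemma invFactorialSub_eq (n k : ℕ) :
    invFactorialSub n k = (n + 1 - k) * invFactorialSub (n + 1) k := by
  rw [← invFactorialSub_succ_succ, invFactorialSub_succ_right]; push_cast; ring

/-- The terms of the well-poised sum evaluated by Dougall's theorem. -/
noncomputable def dougallTerm (l : ℂ) (a s L : ℕ) : ℂ :=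
  risingFac (2 * l) (2 * L) * (l + 2 * L) / ((2 * L).factorial : ℂ) *
    (invFactorialSub s L * invFactorialSub a L) /
    (risingFac (l + 1) (s + L) * risingFac (l + 1) (a + L))

/-- The antidifference certifying the recurrence of `dougallTerm` in `s`. -/
noncomputable def dougallCert (l : ℂ) (a s L : ℕ) : ℂ :=
  -(risingFac (2 * l) (2 * L) * (L * (2 * L - 1) * (l + a + L)) / ((2 * L).factorial : ℂ) *
    (invFactorialSub (s + 1) L * invFactorialSub a L) /
    (risingFac (l + 1) (s + L) * risingFac (l + 1) (a + L)))

/-- A Zeilberger-type recurrence: once shifted factors are reduced to common ones, only a rational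
identity in l, a, s, L remains. -/
lemma dougallTerm_recurrence {l : ℂ} (hl : ∀ n : ℕ, l + 1 + n ≠ 0) (a s L : ℕ) :
    (2 * s + 1) * (s + 1) * (l + 1 + a + s) * dougallTerm l a (s + 1) L -
      (2 * a + 2 * s + 1) * dougallTerm l a s L =
      dougallCert l a s (L + 1) - dougallCert l a s L := by
  have h1 := risingFac_ne_zero hl (s + L)
  have h2 := risingFac_ne_zero hl (a + L)
  have h3 : l + 1 + s + L ≠ 0 := by have := hl (s + L); push_cast at this; rwa [← add_assoc] at this
  have h4 : l + 1 + a + L ≠ 0 := by have := hl (a + L); push_cast at this; rwa [← add_assoc] at this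
  have h5 : ((2 * L).factorial : ℂ) ≠ 0 := Nat.cast_ne_zero.mpr (Nat.factorial_ne_zero _)
  have h6 : (L : ℂ) + 1 ≠ 0 := Nat.cast_add_one_ne_zero L
  have h7 : 2 * (L : ℂ) + 1 ≠ 0 := by exact_mod_cast Nat.succ_ne_zero (2 * L)
  simp only [dougallTerm, dougallCert]
  rw [invFactorialSub_eq s L, invFactorialSub_succ_right, invFactorialSub_succ_right,
    show s + 1 + L = s + L + 1 by ring, show s + (L + 1) = s + L + 1 by ring,
    show a + (L + 1) = a + L + 1 by ring, show 2 * (L + 1) = 2 * L + 1 + 1 by ring,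
    risingFac_succ (l + 1), risingFac_succ (l + 1), risingFac_succ, risingFac_succ,
    Nat.factorial_succ, Nat.factorial_succ]
  push_cast
  rw [show l + 1 + ((s : ℂ) + L) = l + 1 + s + L by ring,
    show l + 1 + ((a : ℂ) + L) = l + 1 + a + L by ring,
    show 2 * (L : ℂ) + 1 + 1 = 2 * (L + 1) by ring]
  field_simp
  ring

/-- A terminating case of Dougall's `₅F₄` summation theorem. -/
lemma sum_dougallTerm {l : ℂ} (hl : ∀ n : ℕ, l + 1 + n ≠ 0) (a s : ℕ) :
    ∑ L ∈ Finset.range (s + 1), dougallTerm l a s L =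
      l * ((2 * (a + s)).choose (2 * s) : ℂ) /
        (((a + s).factorial : ℂ) * risingFac (l + 1) (a + s)) := by
  induction s with
  | zero => simp [dougallTerm, invFactorialSub]; field_simp
  | succ s ih =>
    have key := Finset.sum_congr (rfl : Finset.range (s + 2) = _)
      fun L _ => dougallTerm_recurrence hl a s L
    -- The extra term at L = s + 1 and both boundary values of the antidifference vanish, so
    -- summation leaves a first-order recurrence in s.
    have e0 : dougallTerm l a s (s + 1) = 0 := by simp [dougallTerm, invFactorialSub]
    have e1 : dougallCert l a s (s + 2) = 0 := by simp [dougallCert, invFactorialSub]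
    have e2 : dougallCert l a s 0 = 0 := by simp [dougallCert]
    rw [Finset.sum_sub_distrib, ← Finset.mul_sum, ← Finset.mul_sum, Finset.sum_range_sub, e1, e2,
      Finset.sum_range_succ (dougallTerm l a s), e0, add_zero, ih, sub_zero, sub_eq_zero] at key
    have h3 : l + 1 + a + s ≠ 0 := by
      have := hl (a + s); push_cast at this; rwa [← add_assoc] at this
    have h6 : (s : ℂ) + 1 ≠ 0 := Nat.cast_add_one_ne_zero s
    have h7 : 2 * (s : ℂ) + 1 ≠ 0 := by exact_mod_cast Nat.succ_ne_zero (2 * s)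
    have h8 : ((a + s).factorial : ℂ) ≠ 0 := Nat.cast_ne_zero.mpr (Nat.factorial_ne_zero _)
    have h9 : (a : ℂ) + s + 1 ≠ 0 := by exact_mod_cast Nat.succ_ne_zero (a + s)
    have h10 := risingFac_ne_zero hl (a + s)
    have c1 : (((2 * (a + s) + 1 + 1).choose (2 * s + 1 + 1) : ℕ) : ℂ) * ((2 * s + 1) * (s + 1)) =
        (2 * a + 2 * s + 1) * (a + s + 1) * ((2 * (a + s)).choose (2 * s) : ℕ) := by
      have d1 := congrArg (Nat.cast (R := ℂ)) (Nat.add_one_mul_choose_eq (2 * (a + s)) (2 * s))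
      have d2 := congrArg (Nat.cast (R := ℂ))
        (Nat.add_one_mul_choose_eq (2 * (a + s) + 1) (2 * s + 1))
      push_cast at d1 d2
      linear_combination (-(2 * (s : ℂ) + 1) / 2) * d2 - ((a : ℂ) + s + 1) * d1
    apply mul_left_cancel₀ (mul_ne_zero (mul_ne_zero h7 h6) h3)
    rw [key, show 2 * (a + (s + 1)) = 2 * (a + s) + 1 + 1 by ring,
      show 2 * (s + 1) = 2 * s + 1 + 1 by ring, ← add_assoc, Nat.factorial_succ, risingFac_succ]
    push_cast
    rw [show l + 1 + ((a : ℂ) + s) = l + 1 + a + s by ring]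
    field_simp
    linear_combination -l * c1

/-! ### Growth bounds and absolute convergence -/

lemma exists_norm_risingFac_le (c : ℂ) :
    ∃ A : ℝ, 0 ≤ A ∧ ∀ n : ℕ, ‖risingFac c n‖ ≤ A ^ n * n.factorial := by
  refine ⟨‖c‖ + 1, by positivity, fun n => ?_⟩
  induction n with
  | zero => simp
  | succ n ih =>
    have h : ‖c + n‖ ≤ (‖c‖ + 1) * (n + 1) := by
      have := norm_add_le c n
      rw [Complex.norm_natCast] at this
      nlinarith [norm_nonneg c, Nat.cast_nonneg (α := ℝ) n, mul_nonneg (norm_nonneg c) n.cast_nonneg]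
    rw [risingFac_succ, norm_mul, Nat.factorial_succ, pow_succ]
    calc _ ≤ _ := mul_le_mul ih h (norm_nonneg _) (by positivity)
      _ = _ := by push_cast; ring

lemma exists_add_one_le_mul_norm_add {c : ℂ} (hc : ∀ n : ℕ, c + n ≠ 0) :
    ∃ D : ℝ, 0 ≤ D ∧ ∀ n : ℕ, (n : ℝ) + 1 ≤ D * ‖c + n‖ := by
  obtain ⟨N, hN⟩ := exists_nat_ge (2 * ‖c‖ + 1)
  have hnn : ∀ i ∈ Finset.range N, 0 ≤ ((i : ℝ) + 1) / ‖c + i‖ := fun i _ => by positivity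
  -- The finite sum handles n < N; for n ≥ N ≥ 2‖c‖ + 1, ‖c + n‖ ≥ n - ‖c‖ ≥ (n + 1)/2, so 2
  -- suffices.
  refine ⟨2 + ∑ i ∈ Finset.range N, ((i : ℝ) + 1) / ‖c + i‖,
    add_nonneg zero_le_two (Finset.sum_nonneg hnn), fun n => ?_⟩
  rcases lt_or_ge n N with h | h
  · rw [← div_le_iff₀ (norm_pos_iff.mpr (hc n))]
    have := Finset.single_le_sum hnn (Finset.mem_range.mpr h)
    linarith
  · have h1 : (N : ℝ) ≤ n := Nat.cast_le.mpr h
    have h2 : (n : ℝ) - ‖c‖ ≤ ‖c + n‖ := by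
      have := norm_sub_le (c + n) c
      rw [add_sub_cancel_left, Complex.norm_natCast] at this
      linarith
    have := mul_nonneg (Finset.sum_nonneg hnn) (norm_nonneg (c + n))
    nlinarith

lemma exists_one_div_norm_risingFac_le {c : ℂ} (hc : ∀ n : ℕ, c + n ≠ 0) :
    ∃ D : ℝ, 0 ≤ D ∧ ∀ n : ℕ, 1 / ‖risingFac c n‖ ≤ D ^ n / n.factorial := by
  obtain ⟨D, hD, h⟩ := exists_add_one_le_mul_norm_add hc
  have key : ∀ n : ℕ, (n.factorial : ℝ) ≤ D ^ n * ‖risingFac c n‖ := fun n => by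
    induction n with
    | zero => simp
    | succ n ih =>
      rw [risingFac_succ, norm_mul, Nat.factorial_succ, pow_succ]
      push_cast
      calc _ ≤ _ := mul_le_mul (h n) ih (by positivity) (by positivity)
        _ = _ := by ring
  refine ⟨D, hD, fun n => ?_⟩
  rw [div_le_div_iff₀ (norm_pos_iff.mpr (risingFac_ne_zero hc n)) (by positivity), one_mul]
  exact key n

/-- The terms of the triple series obtained by expanding both factors of the Bessel series. -/
noncomputable def besselTripleTerm (l c y : ℂ) (p : ℕ × ℕ × ℕ) : ℂ :=
  y ^ (2 * p.1 + p.2.1 + p.2.2) *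
    (risingFac (2 * l) (2 * p.1) * (l + 2 * p.1) / (l * ((2 * p.1).factorial : ℂ))) *
    (risingFac (1 / 2) (p.1 + p.2.2) / risingFac c (p.1 + p.2.2)) /
    ((p.2.1.factorial : ℂ) * (p.2.2.factorial : ℂ) *
      (risingFac (l + 1) (2 * p.1 + p.2.1) * risingFac (l + 1) (2 * p.1 + p.2.2)))

lemma norm_add_two_mul_le (l : ℂ) (L : ℕ) : ‖l + 2 * L‖ ≤ (‖l‖ + 1) * 4 ^ L := by
  have h1 : ‖l + 2 * L‖ ≤ ‖l‖ + 2 * L := by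
    refine (norm_add_le _ _).trans_eq ?_
    simp
  have h2 : 1 + (L : ℝ) * 3 ≤ 4 ^ L := by
    have := one_add_mul_le_pow (show (-2 : ℝ) ≤ 3 by norm_num) L
    norm_num at this ⊢
    linarith
  have h3 : (0 : ℝ) ≤ L := L.cast_nonneg
  nlinarith [mul_nonneg (norm_nonneg l) h3, norm_nonneg l, mul_le_mul_of_nonneg_left h2 (norm_nonneg l)]

/-- Rising factorials are comparable to factorials up to geometric factors. Hence the terms are
dominated by a product of three exponential series: 1/m! and 1/j! are explicit, and 1/(l+1)_{2L+m}
supplies 1/L!. -/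
lemma summable_besselTripleTerm {l c : ℂ} (hl : ∀ n : ℕ, l + 1 + n ≠ 0) (hc : ∀ n : ℕ, c + n ≠ 0)
    (y : ℂ) : Summable (besselTripleTerm l c y) := by
  obtain ⟨A, hA, hA'⟩ := exists_norm_risingFac_le (2 * l)
  obtain ⟨B, hB, hB'⟩ := exists_norm_risingFac_le (1 / 2)
  obtain ⟨C, hC, hC'⟩ := exists_one_div_norm_risingFac_le hc
  obtain ⟨D, hD, hD'⟩ := exists_one_div_norm_risingFac_le hl
  have hexp := fun x : ℝ => Real.summable_pow_div_factorial x
  have hsum := (((hexp (‖y‖ ^ 2 * A ^ 2 * 4 * (B * C) * D ^ 4)).mul_of_nonneg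
    ((hexp (‖y‖ * D)).mul_of_nonneg (hexp (‖y‖ * (B * C) * D))
      (fun _ => by positivity) (fun _ => by positivity))
      (fun _ => by positivity) (fun _ => by positivity)).mul_left ((‖l‖ + 1) / ‖l‖))
  refine Summable.of_norm_bounded hsum fun ⟨L, m, j⟩ => ?_
  have e1 : ‖risingFac (2 * l) (2 * L)‖ / ((2 * L).factorial : ℝ) ≤ A ^ (2 * L) := by
    rw [div_le_iff₀ (by positivity)]; exact hA' _
  have e2 : ‖l + 2 * L‖ / ‖l‖ ≤ (‖l‖ + 1) / ‖l‖ * 4 ^ L := by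
    rw [div_mul_eq_mul_div]
    exact div_le_div_of_nonneg_right (norm_add_two_mul_le l L) (norm_nonneg l)
  have e3 : ‖risingFac (1 / 2) (L + j)‖ * (1 / ‖risingFac c (L + j)‖) ≤ (B * C) ^ (L + j) := by
    calc _ ≤ _ := mul_le_mul (hB' (L + j)) (hC' (L + j)) (by positivity) (by positivity)
      _ = _ := by rw [mul_pow]; field_simp
  have e4 : 1 / ‖risingFac (l + 1) (2 * L + m)‖ ≤ D ^ (2 * L + m) / L.factorial :=
    (hD' _).trans (div_le_div_of_nonneg_left (by positivity) (by positivity)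
      (Nat.cast_le.mpr (Nat.factorial_le (by omega))))
  have e5 : 1 / ‖risingFac (l + 1) (2 * L + j)‖ ≤ D ^ (2 * L + j) :=
    (hD' _).trans (div_le_self (by positivity) (Nat.one_le_cast.mpr (Nat.factorial_pos _)))
  calc ‖besselTripleTerm l c y (L, m, j)‖
      = ‖y‖ ^ (2 * L + m + j) * (‖risingFac (2 * l) (2 * L)‖ / ((2 * L).factorial : ℝ)) *
        (‖l + 2 * L‖ / ‖l‖) * (‖risingFac (1 / 2) (L + j)‖ * (1 / ‖risingFac c (L + j)‖)) *
        (1 / ‖risingFac (l + 1) (2 * L + m)‖) * (1 / ‖risingFac (l + 1) (2 * L + j)‖) *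
        (1 / (m.factorial * j.factorial : ℝ)) := by
        simp only [besselTripleTerm, norm_mul, norm_div, norm_pow, Complex.norm_natCast]
        simp only [div_eq_mul_inv, mul_inv, one_mul]
        ring
    _ ≤ ‖y‖ ^ (2 * L + m + j) * A ^ (2 * L) * ((‖l‖ + 1) / ‖l‖ * 4 ^ L) * (B * C) ^ (L + j) *
        (D ^ (2 * L + m) / L.factorial) * D ^ (2 * L + j) * (1 / (m.factorial * j.factorial : ℝ)) := by
        gcongr
    _ = _ := by
        simp only [div_eq_mul_inv, mul_inv, one_mul]
        ring

/-! ### Resummation of the triple series -/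

lemma besselTripleTerm_eq_dougallTerm (l c y : ℂ) (L m j : ℕ) :
    y ^ (L + m + (L + j)) * (risingFac (1 / 2) (L + j) / risingFac c (L + j)) *
      dougallTerm l (L + m) (L + j) L / l = besselTripleTerm l c y (L, m, j) := by
  simp only [dougallTerm, besselTripleTerm, invFactorialSub]
  rw [if_pos (by omega), if_pos (by omega), Nat.add_sub_cancel_left, Nat.add_sub_cancel_left,
    show L + m + (L + j) = 2 * L + m + j by ring, show L + j + L = 2 * L + j by ring,
    show L + m + L = 2 * L + m by ring]
  simp only [div_eq_mul_inv, mul_inv, one_mul]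
  ring

lemma tsum_besselTripleTerm {l c : ℂ} (hl : ∀ n : ℕ, l + n ≠ 0) (hc : ∀ n : ℕ, c + n ≠ 0)
    (y : ℂ) : ∑' p, besselTripleTerm l c y p =
      ∑' n : ℕ, y ^ n / (n.factorial * risingFac (l + 1) n) *
        (risingFac (c - 1 / 2 + n) n / risingFac c n) := by
  have hl0 : l ≠ 0 := by simpa using hl 0
  have hl1 : ∀ n : ℕ, l + 1 + n ≠ 0 := fun n => by
    have := hl (n + 1); push_cast at this; rwa [add_comm (n : ℂ), ← add_assoc] at this
  let g : (ℕ × ℕ) × ℕ → ℂ := fun q => y ^ (q.1.1 + q.1.2) *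
    (risingFac (1 / 2) q.1.2 / risingFac c q.1.2) * dougallTerm l q.1.1 q.1.2 q.2 / l
  -- The image of `e` is L ≤ min(a, s), and `g` vanishes off it, so the series may be summed over
  -- all (a, s, L).
  let e : ℕ × ℕ × ℕ → (ℕ × ℕ) × ℕ := fun p => ((p.1 + p.2.1, p.1 + p.2.2), p.1)
  have he : Function.Injective e := by
    rintro ⟨L, m, j⟩ ⟨L', m', j'⟩ h
    simp only [e, Prod.mk.injEq] at h ⊢
    omega
  have hge : g ∘ e = besselTripleTerm l c y := by
    ext ⟨L, m, j⟩
    exact besselTripleTerm_eq_dougallTerm l c y L m j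
  have hzero : ∀ a s L, ¬ (L ≤ a ∧ L ≤ s) → dougallTerm l a s L = 0 := fun a s L h => by
    rcases not_and_or.mp h with h | h <;> simp [dougallTerm, invFactorialSub, h]
  have hrange : ∀ q, q ∉ Set.range e → g q = 0 := by
    rintro ⟨⟨a, s⟩, L⟩ hq
    simp only [g]
    rw [hzero, mul_zero, zero_div]
    rintro ⟨h1, h2⟩
    refine hq ⟨(L, a - L, s - L), ?_⟩
    simp only [e, Prod.mk.injEq, and_true]
    exact ⟨Nat.add_sub_cancel' h1, Nat.add_sub_cancel' h2⟩
  have hg : Summable g := by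
    rw [← he.summable_iff hrange, hge]
    exact summable_besselTripleTerm hl1 hc y
  have hinner : ∀ a s, ∑' L, g ((a, s), L) =
      y ^ (a + s) / ((a + s).factorial * risingFac (l + 1) (a + s)) *
        (((2 * (a + s)).choose (2 * s) : ℂ) * (risingFac (1 / 2) s / risingFac c s)) := fun a s => by
    simp only [g]
    rw [tsum_eq_sum (s := Finset.range (s + 1)) fun L hL => by
      rw [hzero _ _ _ (by simp at hL; omega), mul_zero, zero_div],
      ← Finset.sum_div, ← Finset.mul_sum, sum_dougallTerm hl1]
    generalize risingFac (1 / 2) s = r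
    field_simp
  have hsum := he.tsum_eq (f := g) fun q hq => by
    by_contra h
    exact hq (hrange q h)
  rw [← hge]
  refine hsum.trans ?_
  rw [hg.tsum_prod, ← Finset.HasAntidiagonal.sigmaAntidiagonalEquivProd.tsum_eq]
  refine (((Finset.HasAntidiagonal.sigmaAntidiagonalEquivProd.summable_iff).mpr
    hg.prod).tsum_sigma' fun n => (hasSum_fintype _).summable).trans ?_
  refine tsum_congr fun n => ?_
  rw [tsum_fintype]
  refine (Finset.sum_coe_sort (Finset.HasAntidiagonal.antidiagonal n)
    fun p => ∑' L, g (p, L)).trans ?_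
  rw [← Finset.Nat.sum_antidiagonal_swap, Finset.Nat.sum_antidiagonal_eq_sum_range_succ_mk,
    ← sum_choose_two_mul_risingFac_div hc, Finset.mul_sum]
  refine Finset.sum_congr rfl fun s hs => ?_
  have hs' : s ≤ n := Nat.lt_succ_iff.mp (Finset.mem_range.mp hs)
  rw [Prod.swap_prod_mk, hinner, Nat.sub_add_cancel hs']

/-! ### Matching the Bessel coefficients -/

/-- Principal powers do not split over quotients in general; here they do because 2 is a positive
real. -/
lemma div_two_cpow {k : ℂ} (hk : k ≠ 0) (l : ℂ) : (k / 2) ^ l = k ^ l / 2 ^ l := by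
  have h : Complex.log k = Complex.log 2 + Complex.log (k / 2) := by
    have := Complex.log_ofReal_mul (r := 2) two_pos (div_ne_zero hk two_ne_zero)
    rw [Complex.ofReal_ofNat, mul_div_cancel₀ _ (two_ne_zero' ℂ)] at this
    rw [this, ← Complex.ofReal_ofNat, ← Complex.ofReal_log zero_le_two]
  rw [Complex.cpow_def_of_ne_zero (div_ne_zero hk two_ne_zero), Complex.cpow_def_of_ne_zero hk,
    Complex.cpow_def_of_ne_zero two_ne_zero, ← Complex.exp_sub, h]
  congr 1; ring

lemma pochhammerSymbol_natCast {c : ℂ} (hc : ∀ n : ℕ, c + n ≠ 0) (n : ℕ) :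
    pochhammerSymbol c n = risingFac c n := by
  have h : Complex.Gamma c ≠ 0 :=
    Complex.Gamma_ne_zero fun m h => hc m (by rw [h, neg_add_cancel])
  rw [pochhammerSymbol, add_comm, Gamma_add_natCast hc, mul_div_cancel_right₀ _ h]

lemma besselJ_two_mul_add (k : ℂ) {l : ℂ} (hl : ∀ n : ℕ, l + 1 + n ≠ 0) (L : ℕ) :
    besselJ (2 * L + l) k = (k / 2) ^ (2 * L + l) / Complex.Gamma (l + 1) *
      ∑' m : ℕ, (-k ^ 2 / 4) ^ m / (m.factorial * risingFac (l + 1) (2 * L + m)) := by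
  rw [besselJ, div_mul_eq_mul_div, mul_div_assoc, ← tsum_div_const]
  congr 1
  refine tsum_congr fun m => ?_
  rw [show (m : ℂ) + (2 * L + l) + 1 = l + 1 + ((2 * L + m : ℕ) : ℂ) by push_cast; ring,
    Gamma_add_natCast hl, show -k ^ 2 / 4 = -1 * (k / 2) ^ 2 by ring, mul_pow, ← pow_mul]
  simp only [div_eq_mul_inv, mul_inv]
  ring

/-- Splitting (1/2)_{L+j}, (c)_{L+j} and (l+1)_{2L+j} at j = 0 isolates the ₁F₂ in the j-sum; the
m-sum is the Bessel series. -/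
lemma tsum_besselTripleTerm_fiber {l c : ℂ} (hl : ∀ n : ℕ, l + 1 + n ≠ 0)
    (hc : ∀ n : ℕ, c + n ≠ 0) (y : ℂ) (L : ℕ) :
    ∑' q : ℕ × ℕ, besselTripleTerm l c y (L, q) =
      y ^ (2 * L) * (risingFac (2 * l) (2 * L) * (l + 2 * L) / (l * ((2 * L).factorial : ℂ))) *
        (risingFac (1 / 2) L / risingFac c L) / risingFac (l + 1) (2 * L) *
        (∑' m : ℕ, y ^ m / (m.factorial * risingFac (l + 1) (2 * L + m))) *
        hypergeometricPFQ [(L : ℂ) + 1 / 2] [2 * (L : ℂ) + l + 1, (L : ℂ) + c] y := by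
  have hsum := (summable_besselTripleTerm hl hc y).comp_injective (Prod.mk_right_injective L)
  refine hsum.tsum_prod.trans ?_
  rw [mul_assoc, ← tsum_mul_right, ← tsum_mul_left]
  refine tsum_congr fun m => ?_
  rw [hypergeometricPFQ, ← tsum_mul_left, ← tsum_mul_left]
  refine tsum_congr fun j => ?_
  have e1 := risingFac_add (1 / 2) L j
  have e2 := risingFac_add c L j
  have e3 := risingFac_add (l + 1) (2 * L) j
  rw [show 1 / 2 + (L : ℂ) = L + 1 / 2 by ring] at e1
  rw [add_comm c] at e2
  rw [show l + 1 + ((2 * L : ℕ) : ℂ) = 2 * L + l + 1 by push_cast; ring] at e3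
  simp only [Function.comp_apply, besselTripleTerm, List.map_cons, List.map_nil, List.prod_cons,
    List.prod_nil, mul_one, ← risingFac_def, e1, e2, e3]
  rw [pow_add, pow_add]
  generalize y ^ (2 * L) = y1
  generalize risingFac (l + 1) (2 * L + m) = P1
  generalize risingFac (l + 1) (2 * L) = P2
  generalize risingFac (2 * l) (2 * L) = P3
  generalize risingFac (1 / 2) L = P4
  generalize risingFac (L + 1 / 2) j = P5
  simp only [div_eq_mul_inv, mul_inv]
  ring

lemma prefactor_mul_besselSeriesTerm {k μ l : ℂ} (hk : k ≠ 0) (hl : ∀ n : ℕ, 2 * l + n ≠ 0)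
    (hμ : ∀ n : ℕ, μ + 1 + n ≠ 0) (L : ℕ) :
    (2 : ℂ) ^ (μ - 1 / 2) * Complex.Gamma (l + 1) * Complex.Gamma (μ + 1) /
      (Complex.Gamma (l + 1 / 2) * Complex.Gamma l ^ 2) * besselSeriesTerm k μ l L =
      ∑' q : ℕ × ℕ, besselTripleTerm l (μ + 1) (-k ^ 2 / 4) (L, q) := by
  have hl0 : ∀ n : ℕ, l + n ≠ 0 := fun n h => hl (2 * n) (by push_cast; linear_combination 2 * h)
  have hl1 : ∀ n : ℕ, l + 1 + n ≠ 0 := fun n h => hl0 (n + 1) (by push_cast; linear_combination h)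
  have hlh : ∀ n : ℕ, l + 1 / 2 + n ≠ 0 := fun n h =>
    hl (2 * n + 1) (by push_cast; linear_combination 2 * h)
  have hl2 : ∀ n : ℕ, 2 * L + 2 * l + n ≠ 0 := fun n h =>
    hl (2 * L + n) (by push_cast; linear_combination h)
  have hhalf : ∀ n : ℕ, (1 / 2 : ℂ) + n ≠ 0 := fun n h => by
    have : ((2 * n + 1 : ℕ) : ℂ) = 0 := by push_cast; linear_combination 2 * h
    exact absurd (Nat.cast_eq_zero.mp this) (by omega)
  have hG : ∀ {c : ℂ}, (∀ n : ℕ, c + n ≠ 0) → Complex.Gamma c ≠ 0 := fun hc =>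
    Complex.Gamma_ne_zero fun m h => hc m (by rw [h, neg_add_cancel])
  have hle : l ≠ 0 := by simpa using hl0 0
  have dup := Complex.Gamma_mul_Gamma_add_half l
  have p1 : pochhammerSymbol (l + 1 / 2) (2 * L) = risingFac (l + 1 / 2) (2 * L) := by
    rw [← pochhammerSymbol_natCast hlh]; push_cast; rfl
  have p2 : pochhammerSymbol (2 * l) (2 * L) = risingFac (2 * l) (2 * L) := by
    rw [← pochhammerSymbol_natCast hl]; push_cast; rfl
  have p3 : pochhammerSymbol (2 * L + 2 * l) (2 * L) = risingFac (2 * L + 2 * l) (2 * L) := by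
    rw [← pochhammerSymbol_natCast hl2]; push_cast; rfl
  have p4 : pochhammerSymbol (L + 1 / 2) (μ + 1 / 2) = risingFac (μ + 1) L *
      Complex.Gamma (μ + 1) / (risingFac (1 / 2) L * Complex.Gamma (1 / 2)) := by
    rw [pochhammerSymbol, ← Gamma_add_natCast hμ, ← Gamma_add_natCast hhalf]
    congr 2 <;> ring
  have g1 : Complex.Gamma (2 * L + l + 1) = risingFac (l + 1) (2 * L) * Complex.Gamma (l + 1) := by
    rw [← Gamma_add_natCast hl1]; congr 1; push_cast; ring
  have g2 : Complex.Gamma (2 * L + 2 * l) = risingFac (2 * l) (2 * L) * Complex.Gamma (2 * l) := by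
    rw [← Gamma_add_natCast hl]; congr 1; push_cast; ring
  have q1 : k ^ (2 * (L : ℂ) - l) = k ^ (2 * L) / k ^ l := by
    rw [Complex.cpow_sub _ _ hk, ← Complex.cpow_natCast k (2 * L)]; push_cast; rfl
  have q2 : (k / 2) ^ (2 * (L : ℂ) + l) = k ^ (2 * L) / 2 ^ (2 * L) * (k ^ l / 2 ^ l) := by
    rw [Complex.cpow_add _ _ (div_ne_zero hk two_ne_zero), div_two_cpow hk l, ← div_pow,
      ← Complex.cpow_natCast (k / 2) (2 * L)]
    push_cast; rfl
  have q3 : (2 : ℂ) ^ (μ - 1 / 2) * 2 ^ (6 * (L : ℂ) - l - μ + 3 / 2) =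
      2 ^ (2 * L) * 2 ^ (2 * L) * 2 ^ (2 * L) * 2 ^ (1 - 2 * l) * 2 ^ l := by
    rw [← pow_add, ← pow_add, ← Complex.cpow_natCast, ← Complex.cpow_add _ _ two_ne_zero,
      ← Complex.cpow_add _ _ two_ne_zero, ← Complex.cpow_add _ _ two_ne_zero]
    congr 1; push_cast; ring
  have q4 : (-k ^ 2 / 4) ^ (2 * L) =
      k ^ (2 * L) * k ^ (2 * L) / (2 ^ (2 * L) * 2 ^ (2 * L)) := by
    rw [← mul_pow, ← mul_pow, ← div_pow, pow_mul, pow_mul]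
    congr 1; ring
  -- Both sides are (2l)_{4L}: split at index 2L on the left, duplicated on the right.
  have r1 : risingFac (2 * l) (2 * L) * risingFac (2 * L + 2 * l) (2 * L) =
      2 ^ (2 * L) * 2 ^ (2 * L) * risingFac l (2 * L) * risingFac (l + 1 / 2) (2 * L) := by
    have h := risingFac_two_mul l (2 * L)
    rw [two_mul (2 * L), risingFac_add] at h
    rw [← mul_pow, show (2 : ℂ) * 2 = 4 by norm_num, ← h]
    congr 2; push_cast; ring
  have r2 : risingFac l (2 * L) * (2 * L + l) = l * risingFac (l + 1) (2 * L) := by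
    rw [← risingFac_succ_left, risingFac_succ]; push_cast; ring
  have n1 := risingFac_ne_zero hl0 (2 * L)
  have n2 := risingFac_ne_zero hl1 (2 * L)
  have n3 := risingFac_ne_zero hlh (2 * L)
  have n4 := risingFac_ne_zero hl (2 * L)
  have n5 := risingFac_ne_zero hl2 (2 * L)
  have n6 := risingFac_ne_zero hμ L
  have n7 := risingFac_ne_zero hhalf L
  have n8 : 2 * (L : ℂ) + l ≠ 0 := by
    have := hl0 (2 * L); push_cast at this; rwa [add_comm]
  have n9 := hG hl0
  have n10 := hG hlh
  have n11 := hG hμ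
  have n12 := hG hhalf
  have n13 : ((2 * L).factorial : ℂ) ≠ 0 := Nat.cast_ne_zero.mpr (Nat.factorial_ne_zero _)
  have n14 : k ^ l ≠ 0 := by simp [Complex.cpow_eq_zero_iff, hk]
  have n15 : (2 : ℂ) ^ l ≠ 0 := by simp [Complex.cpow_eq_zero_iff]
  have n16 : (2 : ℂ) ^ (2 * L) ≠ 0 := pow_ne_zero _ two_ne_zero
  have n17 : (2 : ℂ) ^ (μ - 1 / 2) ≠ 0 := by simp [Complex.cpow_eq_zero_iff]
  have n18 := hG (c := 2 * l) hl
  have hs : ((√Real.pi : ℝ) : ℂ) = Complex.Gamma (1 / 2) := by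
    rw [Complex.Gamma_one_half_eq, Real.sqrt_eq_rpow, Complex.ofReal_cpow Real.pi_pos.le]
    norm_num
  rw [hs] at dup
  rw [tsum_besselTripleTerm_fiber hl1 hμ, besselSeriesTerm, besselJ_two_mul_add k hl1, p1, p2, p3,
    p4, g1, g2, q1, q2, q4, Complex.Gamma_add_one l hle, ← add_assoc (L : ℂ) μ 1,
    Even.neg_one_pow (even_two_mul L), add_comm l (2 * (L : ℂ))]
  generalize hypergeometricPFQ _ _ _ = X
  generalize (∑' m : ℕ, (-k ^ 2 / 4) ^ m /
    ((m.factorial : ℂ) * risingFac (l + 1) (2 * L + m))) = Z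
  -- With the special values made opaque, the claim is a rational identity modulo `r1`, `r2`, `q3`
  -- and Legendre duplication `dup`; each is solved for one variable.
  generalize risingFac (1 / 2) L = r at *
  generalize risingFac (2 * L + 2 * l) (2 * L) = W at *
  generalize risingFac (l + 1 / 2) (2 * L) = S at *
  generalize Complex.Gamma (1 / 2) = sp at *
  generalize Complex.Gamma (l + 1 / 2) = h at *
  generalize (2 : ℂ) ^ (μ - 1 / 2) = u1 at *
  generalize (2 : ℂ) ^ (6 * (L : ℂ) - l - μ + 3 / 2) = u2 at *
  generalize (2 : ℂ) ^ (1 - 2 * l) = u3 at *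
  generalize (2 : ℂ) ^ (2 * L) = v at *
  generalize k ^ (2 * L) = w at *
  generalize risingFac l (2 * L) = Q at *
  generalize risingFac (2 * l) (2 * L) = R at *
  generalize risingFac (l + 1) (2 * L) = P at *
  generalize Complex.Gamma (2 * l) = d at *
  have hP : P = Q * (2 * L + l) / l := by field_simp; rw [r2]; ring
  have hu3 : u3 = Complex.Gamma l * h / (d * sp) := by
    field_simp; rw [dup]; ring
  have hS : S = R * W / (v * v * Q) := by field_simp; rw [r1]; ring
  have hu2 : u2 = v * v * v * u3 * 2 ^ l / u1 := by field_simp; rw [mul_comm, q3]; ring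
  rw [hu2, hu3, hS, hP]
  field_simp

/-! ### The left side and the conclusion -/

/-- Duplication gives 4^n (μ/2+1/4)_n (μ/2+3/4)_n = (μ+1/2)_{2n} = (μ+1/2)_n (μ+1/2+n)_n, and
(μ+1/2)_n cancels a lower parameter. -/
lemma hypergeometricPFQ_eq_tsum_risingFac {μ l : ℂ} (hl : ∀ n : ℕ, l + 1 + n ≠ 0)
    (hμ : ∀ n : ℕ, μ + 1 + n ≠ 0) (hμ' : ∀ n : ℕ, μ + 1 / 2 + n ≠ 0) (k : ℂ) :
    hypergeometricPFQ [μ / 2 + 1 / 4, μ / 2 + 3 / 4] [l + 1, μ + 1 / 2, μ + 1] (-k ^ 2) =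
      ∑' n : ℕ, (-k ^ 2 / 4) ^ n / (n.factorial * risingFac (l + 1) n) *
        (risingFac (μ + 1 - 1 / 2 + n) n / risingFac (μ + 1) n) := by
  refine tsum_congr fun n => ?_
  have h := risingFac_two_mul (μ / 2 + 1 / 4) n
  rw [two_mul n, risingFac_add, show 2 * (μ / 2 + 1 / 4) = μ + 1 / 2 by ring,
    show μ / 2 + 1 / 4 + 1 / 2 = μ / 2 + 3 / 4 by ring] at h
  rw [show μ + 1 - 1 / 2 + n = μ + 1 / 2 + n by ring, div_pow]
  simp only [List.map_cons, List.map_nil, List.prod_cons, List.prod_nil, mul_one]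
  change risingFac _ _ * risingFac _ _ / (risingFac _ _ * (risingFac _ _ * risingFac _ _)) * _ = _
  have n1 := risingFac_ne_zero hl n
  have n2 := risingFac_ne_zero hμ n
  have n3 := risingFac_ne_zero hμ' n
  have n4 : (n.factorial : ℂ) ≠ 0 := Nat.cast_ne_zero.mpr (Nat.factorial_ne_zero _)
  have n5 : (4 : ℂ) ^ n ≠ 0 := pow_ne_zero _ (by norm_num)
  generalize risingFac (μ + 1 / 2) n = a at *
  generalize risingFac (μ + 1 / 2 + n) n = b at *
  generalize risingFac (μ / 2 + 1 / 4) n = a1 at *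
  generalize risingFac (μ / 2 + 3 / 4) n = a2 at *
  generalize (-k ^ 2) ^ n = z at *
  field_simp
  linear_combination -z * h

theorem mainTheorem7 (k μ lam : ℂ) (hk : k ≠ 0)
    (hμ : ∀ n : ℕ, 2 * μ ≠ -((n : ℂ) + 1))
    (hlam : ∀ n : ℕ, 2 * lam ≠ -(n : ℂ)) :
    Summable (fun L : ℕ => besselSeriesTerm k μ lam L) ∧
      hypergeometricPFQ [μ / 2 + 1 / 4, μ / 2 + 3 / 4] [lam + 1, μ + 1 / 2, μ + 1] (-k ^ 2) =
        (2 : ℂ) ^ (μ - 1 / 2) * Complex.Gamma (lam + 1) * Complex.Gamma (μ + 1) /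
            (Complex.Gamma (lam + 1 / 2) * Complex.Gamma lam ^ 2) *
          ∑' L : ℕ, besselSeriesTerm k μ lam L := by
  have hl : ∀ n : ℕ, 2 * lam + n ≠ 0 := fun n h => hlam n (eq_neg_of_add_eq_zero_left h)
  have hl0 : ∀ n : ℕ, lam + n ≠ 0 := fun n h => hl (2 * n) (by push_cast; linear_combination 2 * h)
  have hl1 : ∀ n : ℕ, lam + 1 + n ≠ 0 := fun n h =>
    hl0 (n + 1) (by push_cast; linear_combination h)
  have hlh : ∀ n : ℕ, lam + 1 / 2 + n ≠ 0 := fun n h =>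
    hl (2 * n + 1) (by push_cast; linear_combination 2 * h)
  have hμ1 : ∀ n : ℕ, μ + 1 + n ≠ 0 := fun n h =>
    hμ (2 * n + 1) (by push_cast; linear_combination 2 * h)
  have hμ2 : ∀ n : ℕ, μ + 1 / 2 + n ≠ 0 := fun n h =>
    hμ (2 * n) (by push_cast; linear_combination 2 * h)
  have hG : ∀ {c : ℂ}, (∀ n : ℕ, c + n ≠ 0) → Complex.Gamma c ≠ 0 := fun hc =>
    Complex.Gamma_ne_zero fun m h => hc m (by rw [h, neg_add_cancel])
  have hpre : (2 : ℂ) ^ (μ - 1 / 2) * Complex.Gamma (lam + 1) * Complex.Gamma (μ + 1) /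
      (Complex.Gamma (lam + 1 / 2) * Complex.Gamma lam ^ 2) ≠ 0 :=
    div_ne_zero (mul_ne_zero (mul_ne_zero (by simp [Complex.cpow_eq_zero_iff]) (hG hl1)) (hG hμ1))
      (mul_ne_zero (hG hlh) (pow_ne_zero _ (hG hl0)))
  have hsum := summable_besselTripleTerm hl1 hμ1 (-k ^ 2 / 4)
  constructor
  -- Up to the nonzero prefactor, the terms are the sums over (m, j) of an absolutely convergent
  -- triple series.
  · rw [← summable_mul_left_iff hpre]
    simp only [prefactor_mul_besselSeriesTerm hk hl hμ1]
    exact hsum.prod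
  · rw [← tsum_mul_left, hypergeometricPFQ_eq_tsum_risingFac hl1 hμ1 hμ2,
      ← tsum_besselTripleTerm hl0 hμ1, hsum.tsum_prod]
    exact tsum_congr fun L => (prefactor_mul_besselSeriesTerm hk hl hμ1 L).symm
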